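/- For a finite sequence $\mathbf{s}=(s_1,\dots,s_\ell)$ of positive integers which is empty or has $s_1\ge 2$, let $$\zeta^\star(\mathbf{s})=\lim_{N\to\infty}\ \sum_{N\ge k_1\ge k_2\ge\cdots\ge k_\ell\ge 1}\ \prod_{i=1}^{\ell}\frac{1}{k_i^{s_i}}$$ be the multiple zeta star value, with $\zeta^\star(\emptyset)=1$. Write $\{a_1,\dots,a_p\}^r$ for the sequence $(a_1,\dots,a_p)$ repeated $r$ times. Let $m$ and $n$ be nonnegative integers. (i) We have $$\zeta^\star(\{2\}^n,3,\{2\}^m,1)+\zeta^\star(\{2\}^m,3,\{2\}^n,1)=\zeta^\star(\{2\}^{n+1})\,\zeta^\star(\{2\}^{m+1}).$$ (ii) We have $$(2n+1)\,\zeta^\star(\{3,1\}^n,2)=\sum_{\substack{j+k=n\\ j,k\ge 0}}\zeta^\star(\{3,1\}^j)\,\zeta^\star(\{2\}^{2k+1}).$$ (iii) If $n\ge 1$, then $$\sum_{\substack{e_1+e_2+\cdots+e_{2n}=1\\ e_1,\dots,e_{2n}\ge 0}}\zeta^\star(\{2\}^{e_1},3,\{2\}^{e_2},1,\dots,\{2\}^{e_{2n-1}},3,\{2\}^{e_{2n}},1)=\sum_{\substack{j+k=n-1\\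 j,k\ge 0}}\zeta^\star(\{3,1\}^j,2)\,\zeta^\star(\{2\}^{2k+2}),$$ where the $e_i$ are integers. -/

import Mathlib

open Filter Topology

/-- The multiple harmonic star sum
`H*_N(s₁, …, s_l) = ∑_{N ≥ k₁ ≥ k₂ ≥ ⋯ ≥ k_l ≥ 1} ∏ i, 1 / k_i ^ s_i`
(equal to `1` for the empty index). -/
noncomputable def harmonicStar (N : ℕ) (s : List ℕ) : ℝ :=
  ∑ k ∈ (Fintype.piFinset fun _ : Fin s.length => Finset.Icc 1 N).filter (fun k => Antitone k),
    ∏ i, 1 / (k i : ℝ) ^ s.get i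

/-- The multiple zeta star value `ζ*(s) = lim_{N → ∞} H*_N(s)`. The limit exists for every
index used below, see `tendsto_harmonicStar`. -/
noncomputable def zetaStar (s : List ℕ) : ℝ :=
  limUnder atTop fun N => harmonicStar N s

/-- `{s}^r`: the index `s` repeated `r` times. -/
def repeatIndex (s : List ℕ) (r : ℕ) : List ℕ :=
  (List.replicate r s).flatten

/-- The index `({2}^{e₁}, 3, {2}^{e₂}, 1, …, {2}^{e_{2n-1}}, 3, {2}^{e_{2n}}, 1)`.
The `Fin`-position `i` corresponds to `e_{i+1}`, so even positions carry `3`, odd ones `1`. -/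
def insertedIndex (n : ℕ) (e : Fin (2 * n) → ℕ) : List ℕ :=
  (List.finRange (2 * n)).flatMap fun i =>
    repeatIndex [2] (e i) ++ [if (i : ℕ) % 2 = 0 then 3 else 1]

theorem harmonicStar_mono (s : List ℕ) : Monotone fun N => harmonicStar N s := by
  intro M N h
  apply Finset.sum_le_sum_of_subset_of_nonneg
  · apply Finset.filter_subset_filter
    apply Fintype.piFinset_subset
    intro _
    exact Finset.Icc_subset_Icc le_rfl h
  · intro k _ _
    exact Finset.prod_nonneg fun i _ => by positivity

theorem harmonicStar_bddAbove (a : ℕ) (t : List ℕ) (ha : 2 ≤ a) (ht : ∀ x ∈ t, 1 ≤ x) :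
    BddAbove (Set.range fun N => harmonicStar N (a :: t)) := by
  set d : ℝ := (t.length : ℝ) + 1 with hd
  have hd0 : 0 < d := by positivity
  have hsum : Summable fun n : ℕ => 1 / (n : ℝ) ^ (1 + 1 / d) :=
    Real.summable_one_div_nat_rpow.2 (by have : 0 < 1 / d := by positivity
                                         linarith)
  refine ⟨(∑' n : ℕ, 1 / (n : ℝ) ^ (1 + 1 / d)) ^ (t.length + 1), ?_⟩
  rintro _ ⟨N, rfl⟩
  have key : ∀ k : Fin (t.length + 1) → ℕ, (∀ i, 1 ≤ k i) → Antitone k →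
      ∏ i : Fin (t.length + 1), 1 / (k i : ℝ) ^ (a :: t).get i
        ≤ ∏ i, 1 / (k i : ℝ) ^ (1 + 1 / d) := by
    intro k hk hanti
    have hk' : ∀ i, (1 : ℝ) ≤ k i := fun i => by exact_mod_cast hk i
    have hp : ∏ i, (k i : ℝ) ^ (1 + 1 / d) ≤
        ∏ i : Fin (t.length + 1), (k i : ℝ) ^ (a :: t).get i := by
      have h1 : ∏ i, (k i : ℝ) ^ (1 + 1 / d) = (∏ i, (k i : ℝ)) * (∏ i, (k i : ℝ)) ^ (1 / d) := by
        rw [← Real.finsetProd_rpow _ _ (fun i _ => by positivity), ← Finset.prod_mul_distrib]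
        refine Finset.prod_congr rfl fun i _ => ?_
        rw [Real.rpow_add (by linarith [hk' i]), Real.rpow_one]
      have h2 : (∏ i, (k i : ℝ)) ^ (1 / d) ≤ k 0 := by
        have h3 : ∏ i, (k i : ℝ) ≤ (k 0 : ℝ) ^ (t.length + 1) := by
          calc ∏ i, (k i : ℝ) ≤ ∏ i : Fin (t.length + 1), (k 0 : ℝ) :=
                Finset.prod_le_prod (fun i _ => by positivity)
                  (fun i _ => by exact_mod_cast hanti (Fin.zero_le i))
            _ = _ := by simp
        calc (∏ i, (k i : ℝ)) ^ (1 / d) ≤ ((k 0 : ℝ) ^ (t.length + 1)) ^ (1 / d) :=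
              Real.rpow_le_rpow (Finset.prod_nonneg fun i _ => by positivity) h3 (by positivity)
          _ = k 0 := by
              rw [← Real.rpow_natCast, ← Real.rpow_mul (by positivity)]
              push_cast
              rw [← hd, mul_one_div_cancel hd0.ne', Real.rpow_one]
      rw [h1]
      calc (∏ i, (k i : ℝ)) * (∏ i, (k i : ℝ)) ^ (1 / d) ≤ (∏ i, (k i : ℝ)) * k 0 :=
            mul_le_mul_of_nonneg_left h2 (Finset.prod_nonneg fun i _ => by positivity)
        _ = (k 0 : ℝ) ^ 2 * ∏ i : Fin t.length, (k i.succ : ℝ) := by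
            rw [Fin.prod_univ_succ]; ring
        _ ≤ (k 0 : ℝ) ^ a * ∏ i : Fin t.length, (k i.succ : ℝ) ^ t.get i := by
            refine mul_le_mul (pow_le_pow_right₀ (hk' 0) ha) ?_
              (Finset.prod_nonneg fun i _ => by positivity) (by positivity)
            refine Finset.prod_le_prod (fun i _ => by positivity) fun i _ => ?_
            exact le_self_pow₀ (hk' _) (by have := ht _ (List.get_mem t i); omega)
        _ = _ := by rw [Fin.prod_univ_succ]; rfl
    simp only [one_div, Finset.prod_inv_distrib] at hp ⊢
    refine inv_anti₀ (Finset.prod_pos fun i _ => ?_) hp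
    have := hk' i
    positivity
  calc harmonicStar N (a :: t)
      ≤ ∑ k ∈ (Fintype.piFinset fun _ : Fin (t.length + 1) => Finset.Icc 1 N).filter
          (fun k => Antitone k), ∏ i, 1 / (k i : ℝ) ^ (1 + 1 / d) := by
        refine Finset.sum_le_sum fun k hk => ?_
        rw [Finset.mem_filter, Fintype.mem_piFinset] at hk
        exact key k (fun i => (Finset.mem_Icc.1 (hk.1 i)).1) hk.2
    _ ≤ ∑ k ∈ Fintype.piFinset fun _ : Fin (t.length + 1) => Finset.Icc 1 N,
          ∏ i, 1 / (k i : ℝ) ^ (1 + 1 / d) :=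
        Finset.sum_le_sum_of_subset_of_nonneg (Finset.filter_subset _ _)
          fun k _ _ => Finset.prod_nonneg fun i _ => by positivity
    _ = (∑ n ∈ Finset.Icc 1 N, 1 / (n : ℝ) ^ (1 + 1 / d)) ^ (t.length + 1) := by
        rw [← Finset.prod_univ_sum (fun _ : Fin (t.length + 1) => Finset.Icc 1 N)
          (fun _ n => 1 / (n : ℝ) ^ (1 + 1 / d))]
        simp
    _ ≤ _ := by
        refine pow_le_pow_left₀ (Finset.sum_nonneg fun n _ => by positivity) ?_ _
        exact hsum.sum_le_tsum _ fun n _ => by positivity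

/-- For an index of positive integers whose first entry, if any, is at least `2`, the limit
defining `zetaStar` exists. -/
theorem tendsto_harmonicStar (s : List ℕ) (hs : ∀ x ∈ s, 1 ≤ x) (h1 : ∀ x ∈ s.head?, 2 ≤ x) :
    Tendsto (fun N => harmonicStar N s) atTop (𝓝 (zetaStar s)) := by
  apply tendsto_nhds_limUnder
  cases s with
  | nil => exact ⟨1, by simp [harmonicStar, Finset.filter_true_of_mem, Subsingleton.antitone]⟩
  | cons a t =>
    exact ⟨_, tendsto_atTop_ciSup (harmonicStar_mono _) (harmonicStar_bddAbove a t
      (h1 a (by simp)) fun x hx => hs x (by simp [hx]))⟩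

/-!
The star sums have expansions `H*_N(s) = ∑ k, w_N(k) g_s(k)` in the kernel
`w_N(k) = binom(N, k) / binom(N + k, k)`. Prepending an entry to `s` acts on the coefficients `g`:
since `N² (w_N(k) - w_{N-1}(k)) = k² w_N(k)`, an entry `2` divides `g` by `k²`, and since
`N ∑ w_N(k) g(k) = ∑ k w_N(k) (P g)(k)` with `P g (k) = ∑_{j ≤ k} g(j) + ∑_{j < k} g(j)`
(`mul_sum_kernel`), an entry `1` sends `g` to `P g / k`, while an entry `3` sends it to
`P⁻¹(g / k) / k²`. The inverse of `P` is its conjugate by the sign `(-1)^k`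
(`doubledSum_altDoubledSum`). Hence a block `{2}^a, 3, {2}^b, 1` acts as `y_{2a+2} P y_{2b+2} P`,
where `y_c(k) = (-1)^(k-1) / k^c` (`hasExpansion_word`).

As `w_N(k) → 1`, dominated convergence identifies the star values with the sums
`T(c₁, …, c_p) = ∑_{k₁ ≥ ⋯ ≥ k_p} 2^#{k₁, …, k_p} ∏ y_{cᵢ}(kᵢ)`, where `cᵢ = 2 eᵢ + 2`
(`tendsto_partialSum_word`). The three identities already hold for the truncations of these sums
to `k₁ < K`. The first is `T(a, b) + T(b, a) = T(a) T(b)`. The generating function of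
`T({2}^p)` is `∏ k, (1 + y₂(k) X) / (1 - y₂(k) X)`; differentiating it in the direction `y_d` gives
`insertSum_eq_sum`, whose cases `d = 2` and `d = 4` are the second and third identities.
-/

namespace ZetaStar

/-! ### Iterated sums -/

theorem harmonicStar_nil (N : ℕ) : harmonicStar N [] = 1 := by
  simp [harmonicStar, Finset.filter_true_of_mem, Subsingleton.antitone]

theorem harmonicStar_cons (N a : ℕ) (t : List ℕ) :
    harmonicStar N (a :: t) = ∑ k ∈ Finset.Icc 1 N, harmonicStar k t / (k : ℝ) ^ a := by
  simp only [harmonicStar, Finset.sum_div]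
  rw [Finset.sum_sigma']
  refine Finset.sum_bij' (fun k _ => (⟨k 0, Fin.tail k⟩ : (_ : ℕ) × (Fin t.length → ℕ)))
    (fun p _ => (Fin.cons p.1 p.2 : Fin (t.length + 1) → ℕ)) ?_ ?_ ?_ ?_ ?_
  · intro k hk
    simp only [Finset.mem_filter, Fintype.mem_piFinset, Finset.mem_Icc, Finset.mem_sigma] at hk ⊢
    refine ⟨hk.1 0, fun i => ⟨(hk.1 i.succ).1, hk.2 (Fin.zero_le _)⟩, fun i j hij => ?_⟩
    exact hk.2 (Fin.succ_le_succ_iff.2 hij)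
  · rintro ⟨q, k⟩ hk
    simp only [Finset.mem_filter, Fintype.mem_piFinset, Finset.mem_Icc, Finset.mem_sigma] at hk ⊢
    obtain ⟨hq, hk, hanti⟩ := hk
    constructor
    · intro i
      refine Fin.cases hq (fun j => ?_) i
      exact ⟨(hk j).1, (hk j).2.trans hq.2⟩
    · intro i j hij
      induction i using Fin.cases with
      | zero =>
        induction j using Fin.cases with
        | zero => exact le_rfl
        | succ j => exact (hk j).2
      | succ i =>
        induction j using Fin.cases with
        | zero => exact absurd hij (by simp)
        | succ j => exact hanti (Fin.succ_le_succ_iff.1 hij)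
  · intro k _
    exact Fin.cons_self_tail k
  · rintro ⟨q, k⟩ _
    rfl
  · intro k _
    change ∏ i : Fin (t.length + 1), 1 / (k i : ℝ) ^ (a :: t).get i = _
    rw [Fin.prod_univ_succ, mul_comm, ← div_eq_mul_one_div]
    rfl

/-! ### The kernel -/

/-- The kernel `binom(N, k) / binom(N + k, k) = N!² / ((N - k)! (N + k)!)`, given by its
recurrence in `k`; it vanishes for `k > N`. -/
noncomputable def kernel (N : ℕ) : ℕ → ℝ
  | 0 => 1
  | k + 1 => kernel N k * ((N - k) / (N + k + 1))

theorem kernel_succ_mul (N k : ℕ) :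
    kernel N (k + 1) * (N + k + 1) = kernel N k * (N - k) := by
  rw [kernel]
  field_simp

theorem kernel_eq_zero_of_lt {N k : ℕ} (h : N < k) : kernel N k = 0 := by
  induction k with
  | zero => omega
  | succ k ih =>
    rw [kernel]
    rcases Nat.lt_succ_iff_lt_or_eq.1 h with h | rfl
    · rw [ih h, zero_mul]
    · simp

theorem kernel_nonneg_and_le_one (N k : ℕ) : 0 ≤ kernel N k ∧ kernel N k ≤ 1 := by
  induction k with
  | zero => simp [kernel]
  | succ k ih =>
    rcases lt_or_ge N k with h | h
    · simp [kernel, kernel_eq_zero_of_lt h]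
    · have h' : (k : ℝ) ≤ N := by exact_mod_cast h
      have h0 : 0 ≤ ((N : ℝ) - k) / (N + k + 1) := div_nonneg (by linarith) (by positivity)
      have h1 : ((N : ℝ) - k) / (N + k + 1) ≤ 1 := by
        rw [div_le_one (by positivity)]
        have : (0 : ℝ) ≤ k := by positivity
        linarith
      exact ⟨mul_nonneg ih.1 h0, mul_le_one₀ ih.2 h0 h1⟩

theorem tendsto_kernel (k : ℕ) : Tendsto (fun N => kernel N k) atTop (𝓝 1) := by
  induction k with
  | zero => simp [kernel]
  | succ k ih =>
    have h : Tendsto (fun N : ℕ => ((N : ℝ) - k) / (N + k + 1)) atTop (𝓝 1) := by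
      have h1 : Tendsto (fun N : ℕ => 1 - (2 * k + 1 : ℝ) / ((N : ℝ) + (k + 1))) atTop
          (𝓝 (1 - 0)) :=
        tendsto_const_nhds.sub (Tendsto.div_atTop tendsto_const_nhds
          (tendsto_atTop_add_const_right _ _ tendsto_natCast_atTop_atTop))
      rw [sub_zero] at h1
      refine h1.congr fun N => ?_
      have : (N : ℝ) + (k + 1) ≠ 0 := by positivity
      have : (N : ℝ) + k + 1 ≠ 0 := by positivity
      field_simp
      ring
    simpa [kernel] using ih.mul h

/-- Recurrence in `N`: it turns division by `k ^ 2` of the coefficients into summation against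
`1 / N ^ 2`. -/
theorem kernel_succ_left (N k : ℕ) :
    ((N : ℝ) + 1) ^ 2 * kernel N k = (((N : ℝ) + 1) ^ 2 - (k : ℝ) ^ 2) * kernel (N + 1) k := by
  induction k with
  | zero => simp [kernel]
  | succ k ih =>
    rw [kernel, kernel, ← mul_assoc, ih]
    push_cast
    have h1 : (N : ℝ) + k + 1 ≠ 0 := by positivity
    have h2 : (N : ℝ) + 1 + k + 1 ≠ 0 := by positivity
    field_simp
    ring

/-! ### Coefficient operators -/

/-- The sum `∑_{j ≤ k} g j + ∑_{j < k} g j`, in which every term counts twice except the last. -/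
noncomputable def doubledSum (g : ℕ → ℝ) (k : ℕ) : ℝ :=
  ∑ j ∈ Finset.range (k + 1), g j + ∑ j ∈ Finset.range k, g j

/-- `doubledSum` conjugated by the sign `(-1) ^ k`. -/
noncomputable def altDoubledSum (g : ℕ → ℝ) (k : ℕ) : ℝ :=
  (-1) ^ k * doubledSum (fun j => (-1) ^ j * g j) k

theorem doubledSum_zero (g : ℕ → ℝ) : doubledSum g 0 = g 0 := by
  simp [doubledSum]

theorem doubledSum_succ (g : ℕ → ℝ) (k : ℕ) :
    doubledSum g (k + 1) = doubledSum g k + g k + g (k + 1) := by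
  simp only [doubledSum, Finset.sum_range_succ]
  ring

theorem altDoubledSum_zero (g : ℕ → ℝ) : altDoubledSum g 0 = g 0 := by
  simp [altDoubledSum, doubledSum_zero]

theorem altDoubledSum_succ (g : ℕ → ℝ) (k : ℕ) :
    altDoubledSum g (k + 1) = g (k + 1) - g k - altDoubledSum g k := by
  have h : ((-1 : ℝ) ^ k) * (-1) ^ k = 1 := by rw [← mul_pow]; simp
  simp only [altDoubledSum, doubledSum_succ, pow_succ]
  linear_combination (g (k + 1) - g k) * h

theorem doubledSum_altDoubledSum (g : ℕ → ℝ) (k : ℕ) : doubledSum (altDoubledSum g) k = g k := by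
  induction k with
  | zero => rw [doubledSum_zero, altDoubledSum_zero]
  | succ k ih =>
    rw [doubledSum_succ, ih, altDoubledSum_succ]
    ring

/-- Against the kernel, `doubledSum` trades the factor `N` for the factor `k`. -/
theorem mul_sum_kernel (N : ℕ) (g : ℕ → ℝ) :
    (N : ℝ) * ∑ k ∈ Finset.range (N + 1), kernel N k * g k =
      ∑ k ∈ Finset.range (N + 1), kernel N k * (k * doubledSum g k) := by
  -- The summands differ by a telescoping term, which vanishes at `K = N`.
  have key : ∀ K : ℕ, (N : ℝ) * ∑ k ∈ Finset.range (K + 1), kernel N k * g k =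
      ∑ k ∈ Finset.range (K + 1), kernel N k * (k * doubledSum g k) +
        kernel N K * (N - K) * ∑ j ∈ Finset.range (K + 1), g j := by
    intro K
    induction K with
    | zero => simp [kernel]
    | succ K ih =>
      rw [Finset.sum_range_succ, mul_add, ih,
        Finset.sum_range_succ (fun k => kernel N k * (k * doubledSum g k)) (K + 1)]
      have h := kernel_succ_mul N K
      simp only [doubledSum, Finset.sum_range_succ]
      push_cast
      linear_combination -(∑ j ∈ Finset.range K, g j + g K) * h
  simpa using key N

/-! ### Kernel expansions of star sums -/

/-- The star sums of the index `s` are `∑ k, kernel N k * g k`. The case `N = 0` is left out, as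
the coefficients are only determined up to relations valid for `N ≥ 1`. -/
def HasExpansion (s : List ℕ) (g : ℕ → ℝ) : Prop :=
  ∀ N : ℕ, 1 ≤ N → harmonicStar N s = ∑ k ∈ Finset.range (N + 1), kernel N k * g k

/-- The coefficients `1, 0, 0, …` of the empty index. -/
def unitCoeff (k : ℕ) : ℝ := if k = 0 then 1 else 0

theorem hasExpansion_nil : HasExpansion [] unitCoeff := by
  intro N _
  simp [harmonicStar_nil, unitCoeff, kernel]

/-- Criterion for `h` to be the coefficients of `a :: s`. The increment of the star sum of `a :: s`
at `N` is the star sum of `s` divided by `N ^ a`, and by `kernel_succ_left` the increment of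
`∑ k, kernel N k * h k` is `∑ k, kernel N k * (k ^ 2 * h k) / N ^ 2`. -/
theorem HasExpansion.cons_of_sum_eq {s : List ℕ} {g h : ℕ → ℝ} {a : ℕ} (hs : HasExpansion s g)
    (h0 : h 0 = 0)
    (H : ∀ N : ℕ, 1 ≤ N → (∑ k ∈ Finset.range (N + 1), kernel N k * g k) / (N : ℝ) ^ a =
      ∑ k ∈ Finset.range (N + 1), kernel N k * ((k : ℝ) ^ 2 * h k) / (N : ℝ) ^ 2) :
    HasExpansion (a :: s) h := by
  intro N _
  rw [harmonicStar_cons]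
  clear * - hs H h0
  induction N with
  | zero => simp [h0]
  | succ N ih =>
    rw [Finset.sum_Icc_succ_top (by omega), ih, hs _ (by omega), H _ (by omega)]
    have hext : ∑ k ∈ Finset.range (N + 1), kernel N k * h k =
        ∑ k ∈ Finset.range (N + 1 + 1), kernel N k * h k := by
      rw [Finset.sum_range_succ _ (N + 1), kernel_eq_zero_of_lt (Nat.lt_succ_self N)]
      simp
    rw [hext, ← Finset.sum_add_distrib]
    refine Finset.sum_congr rfl fun k _ => ?_
    have h1 := kernel_succ_left N k
    have h2 : (N : ℝ) + 1 ≠ 0 := by positivity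
    push_cast
    field_simp
    linear_combination h k * h1

theorem HasExpansion.cons_one {s : List ℕ} {g : ℕ → ℝ} (hs : HasExpansion s g) :
    HasExpansion (1 :: s) (fun k => doubledSum g k / k) := by
  refine hs.cons_of_sum_eq (by simp) fun N hN => ?_
  have hN' : (N : ℝ) ≠ 0 := by positivity
  rw [← Finset.sum_div, div_eq_div_iff (by positivity) (by positivity)]
  have h : ∑ k ∈ Finset.range (N + 1), kernel N k * ((k : ℝ) ^ 2 * (doubledSum g k / k)) =
      ∑ k ∈ Finset.range (N + 1), kernel N k * (k * doubledSum g k) := by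
    refine Finset.sum_congr rfl fun k _ => ?_
    rcases eq_or_ne (k : ℝ) 0 with hk | hk
    · simp [hk]
    · field_simp
  rw [h, ← mul_sum_kernel]
  ring

theorem HasExpansion.cons_two {s : List ℕ} {g : ℕ → ℝ} (hs : HasExpansion s g) (h0 : g 0 = 0) :
    HasExpansion (2 :: s) (fun k => g k / (k : ℝ) ^ 2) := by
  refine hs.cons_of_sum_eq (by simp) fun N hN => ?_
  rw [Finset.sum_div]
  refine Finset.sum_congr rfl fun k _ => ?_
  rcases Nat.eq_zero_or_pos k with rfl | hk
  · simp [h0]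
  · have : (k : ℝ) ≠ 0 := by positivity
    field_simp

theorem HasExpansion.cons_three {s : List ℕ} {g : ℕ → ℝ} (hs : HasExpansion s g) (h0 : g 0 = 0) :
    HasExpansion (3 :: s) (fun k => altDoubledSum (fun j => g j / j) k / (k : ℝ) ^ 2) := by
  refine hs.cons_of_sum_eq (by simp) fun N hN => ?_
  have hN' : (N : ℝ) ≠ 0 := by positivity
  rw [← Finset.sum_div, div_eq_div_iff (by positivity) (by positivity)]
  have h := mul_sum_kernel N (altDoubledSum fun j => g j / j)
  have h1 : ∑ k ∈ Finset.range (N + 1), kernel N k *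
        ((k : ℝ) ^ 2 * (altDoubledSum (fun j => g j / j) k / (k : ℝ) ^ 2)) =
      ∑ k ∈ Finset.range (N + 1), kernel N k * altDoubledSum (fun j => g j / j) k := by
    refine Finset.sum_congr rfl fun k _ => ?_
    rcases Nat.eq_zero_or_pos k with rfl | hk
    · simp [altDoubledSum_zero]
    · have : (k : ℝ) ≠ 0 := by positivity
      field_simp
  have h2 : ∑ k ∈ Finset.range (N + 1), kernel N k *
        (k * doubledSum (altDoubledSum fun j => g j / j) k) =
      ∑ k ∈ Finset.range (N + 1), kernel N k * g k := by
    refine Finset.sum_congr rfl fun k _ => ?_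
    rw [doubledSum_altDoubledSum]
    rcases Nat.eq_zero_or_pos k with rfl | hk
    · simp [h0]
    · have : (k : ℝ) ≠ 0 := by positivity
      field_simp
  rw [h1, ← h2, ← h]
  ring

theorem HasExpansion.replicate_two_append {s : List ℕ} {g : ℕ → ℝ} (hs : HasExpansion s g)
    (h0 : g 0 = 0) (a : ℕ) :
    HasExpansion (List.replicate a 2 ++ s) (fun k => g k / (k : ℝ) ^ (2 * a)) := by
  induction a with
  | zero => simpa using hs
  | succ a ih =>
    have h := ih.cons_two (by simp [h0])
    simp only [div_div, ← pow_add] at h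
    exact h

/-! ### Alternating sums -/

/-- The sign-alternating power `(-1) ^ (k - 1) / k ^ c`, set to `0` at `k = 0`. -/
noncomputable def altPow (c k : ℕ) : ℝ :=
  if k = 0 then 0 else (-1) ^ (k + 1) / (k : ℝ) ^ c

/-- The coefficient at `k₁ = k` of the iterated alternating sum
`∑_{k₁ ≥ k₂ ≥ ⋯ ≥ k_p ≥ 1} 2 ^ #{k₁, …, k_p} ∏ i, (-1) ^ (kᵢ - 1) / kᵢ ^ cᵢ`. -/
noncomputable def altCoeff : List ℕ → ℕ → ℝ
  | [] => unitCoeff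
  | c :: l => fun k => altPow c k * doubledSum (altCoeff l) k

/-- The part `k₁ < K` of the iterated alternating sum with exponents `l`. -/
noncomputable def partialSum (l : List ℕ) (K : ℕ) : ℝ :=
  ∑ k ∈ Finset.range K, altCoeff l k

/-- The index `({2}^{e₁}, 3, {2}^{e₂}, 1, {2}^{e₃}, 3, …)` attached to `(e₁, …, e_p)`, ending in
`1` if `p` is even and in `{2}^{e_p + 1}` if `p` is odd. -/
def word : List ℕ → List ℕ
  | [] => []
  | [e] => List.replicate (e + 1) 2
  | a :: b :: l => List.replicate a 2 ++ 3 :: (List.replicate b 2 ++ 1 :: word l)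

/-- The single block `{2}^{e+1}` needs its own argument, as `unitCoeff` does not vanish at `0`;
subtracting `altDoubledSum unitCoeff`, which pairs to `0` with the kernel, makes it vanish. -/
theorem hasExpansion_replicate_two (e : ℕ) :
    HasExpansion (List.replicate (e + 1) 2) (altCoeff [2 * e + 2]) := by
  have h : HasExpansion [] (fun k => unitCoeff k - altDoubledSum unitCoeff k) := by
    intro N hN
    have h1 := mul_sum_kernel N (altDoubledSum unitCoeff)
    have h2 : ∑ k ∈ Finset.range (N + 1), kernel N k *
        (k * doubledSum (altDoubledSum unitCoeff) k) = 0 := by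
      refine Finset.sum_eq_zero fun k _ => ?_
      rw [doubledSum_altDoubledSum]
      rcases Nat.eq_zero_or_pos k with rfl | hk
      · simp
      · simp [unitCoeff, hk.ne']
    have h3 : (N : ℝ) ≠ 0 := by positivity
    rw [h2] at h1
    simp only [mul_sub, Finset.sum_sub_distrib]
    rw [(mul_eq_zero.1 h1).resolve_left h3, sub_zero]
    exact hasExpansion_nil N hN
  have h' := h.replicate_two_append (by simp [altDoubledSum_zero]) (e + 1)
  rw [List.append_nil] at h'
  convert h' using 2 with k
  rcases Nat.eq_zero_or_pos k with rfl | hk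
  · simp [altCoeff, altPow]
  · have hu : (fun j => (-1 : ℝ) ^ j * unitCoeff j) = unitCoeff := by
      funext j
      rcases Nat.eq_zero_or_pos j with rfl | hj
      · simp
      · simp [unitCoeff, hj.ne']
    simp only [altCoeff, altPow, hk.ne', if_false, altDoubledSum, hu]
    rw [show unitCoeff k = 0 by simp [unitCoeff, hk.ne'], show 2 * (e + 1) = 2 * e + 2 by ring]
    ring

theorem hasExpansion_word (l : List ℕ) :
    HasExpansion (word l) (altCoeff (l.map fun e => 2 * e + 2)) := by
  induction l using word.induct with
  | case1 => exact hasExpansion_nil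
  | case2 e => exact hasExpansion_replicate_two e
  | case3 a b l ih =>
    have h := ((ih.cons_one.replicate_two_append (by simp) b).cons_three (by simp)
      ).replicate_two_append (by simp) a
    rw [word]
    convert h using 2 with k
    rcases Nat.eq_zero_or_pos k with rfl | hk
    · simp [altCoeff, altPow]
    · simp only [List.map_cons, altCoeff, altDoubledSum]
      -- The sign of the outer factor is `-(-1) ^ k`; the missing `-1` moves into the inner sum.
      have hneg : doubledSum (fun j => altPow (2 * b + 2) j *
            doubledSum (altCoeff (l.map fun e => 2 * e + 2)) j) k =
          -doubledSum (fun j => (-1) ^ j * (doubledSum (altCoeff (l.map fun e => 2 * e + 2)) j /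
            (j : ℝ) / (j : ℝ) ^ (2 * b) / j)) k := by
        simp only [doubledSum, neg_add, ← Finset.sum_neg_distrib]
        congr 1 <;>
        · refine Finset.sum_congr rfl fun j _ => ?_
          rcases Nat.eq_zero_or_pos j with rfl | hj
          · simp [altPow]
          · have : (j : ℝ) ≠ 0 := by positivity
            simp only [altPow, hj.ne', if_false]
            field_simp
            ring
      rw [hneg]
      have : (k : ℝ) ≠ 0 := by positivity
      simp only [altPow, hk.ne', if_false]
      field_simp
      ring

/-! ### Passing to the limit -/

theorem norm_altPow_le {c : ℕ} (hc : 2 ≤ c) (k : ℕ) : ‖altPow c k‖ ≤ 1 / (k : ℝ) ^ 2 := by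
  rcases Nat.eq_zero_or_pos k with rfl | hk
  · simp [altPow]
  · have h1 : (1 : ℝ) ≤ k := by exact_mod_cast hk
    simp only [altPow, hk.ne', if_false, norm_div, norm_pow, norm_neg, norm_one, one_pow,
      Real.norm_natCast]
    exact one_div_le_one_div_of_le (by positivity) (pow_le_pow_right₀ h1 hc)

theorem summable_norm_altCoeff (l : List ℕ) (hl : ∀ c ∈ l, 2 ≤ c) :
    Summable fun k => ‖altCoeff l k‖ := by
  induction l with
  | nil =>
    refine summable_of_ne_finset_zero (s := {0}) fun k hk => ?_
    have : k ≠ 0 := by simpa using hk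
    simp [altCoeff, unitCoeff, this]
  | cons c l ih =>
    have hs := ih fun x hx => hl x (by simp [hx])
    refine Summable.of_nonneg_of_le (fun _ => norm_nonneg _) (fun k => ?_)
      ((Real.summable_one_div_nat_pow.2 (by norm_num : 1 < 2)).mul_right
        (∑' j, ‖altCoeff l j‖ + ∑' j, ‖altCoeff l j‖))
    rw [altCoeff, norm_mul]
    refine mul_le_mul (norm_altPow_le (hl c (by simp)) k) ?_ (norm_nonneg _) (by positivity)
    have hb : ∀ K : ℕ, ‖∑ j ∈ Finset.range K, altCoeff l j‖ ≤ ∑' j, ‖altCoeff l j‖ := fun K =>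
      (norm_sum_le _ _).trans (hs.sum_le_tsum _ fun _ _ => norm_nonneg _)
    exact (norm_add_le _ _).trans (add_le_add (hb _) (hb _))

/-- The iterated alternating sums converge to the star values: the kernel takes
values in `[0, 1]` and tends to `1`, so dominated convergence applies to the expansion. -/
theorem tendsto_partialSum_word (l : List ℕ) :
    Tendsto (partialSum (l.map fun e => 2 * e + 2)) atTop (𝓝 (zetaStar (word l))) := by
  set c := l.map fun e => 2 * e + 2 with hc
  have hs := summable_norm_altCoeff c (by simp [hc])
  have h1 : Tendsto (fun N => ∑' k, kernel N k * altCoeff c k) atTop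
      (𝓝 (∑' k, altCoeff c k)) := by
    refine tendsto_tsum_of_dominated_convergence hs (fun k => ?_) (Eventually.of_forall ?_)
    · simpa using (tendsto_kernel k).mul_const (altCoeff c k)
    · intro N k
      have := kernel_nonneg_and_le_one N k
      rw [norm_mul, Real.norm_of_nonneg this.1]
      exact mul_le_of_le_one_left (norm_nonneg _) this.2
  have h2 : Tendsto (fun N => harmonicStar N (word l)) atTop (𝓝 (∑' k, altCoeff c k)) := by
    refine h1.congr' ?_
    filter_upwards [eventually_ge_atTop 1] with N hN
    rw [hasExpansion_word l N hN, tsum_eq_sum]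
    intro k hk
    rw [kernel_eq_zero_of_lt (by simpa using hk), zero_mul]
  rw [zetaStar, h2.limUnder_eq]
  exact hs.of_norm.hasSum.tendsto_sum_nat

/-! ### Identities between the partial sums -/

theorem partialSum_cons_succ (c : ℕ) (l : List ℕ) (K : ℕ) :
    partialSum (c :: l) (K + 1) =
      partialSum (c :: l) K + altPow c K * (partialSum l (K + 1) + partialSum l K) := by
  rw [partialSum, Finset.sum_range_succ]
  rfl

theorem partialSum_nil_succ (K : ℕ) : partialSum [] (K + 1) = 1 := by
  simp [partialSum, altCoeff, unitCoeff]

theorem partialSum_cons_one (c : ℕ) (l : List ℕ) : partialSum (c :: l) 1 = 0 := by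
  simp [partialSum, altCoeff, altPow]

theorem partialSum_singleton_succ (c K : ℕ) :
    partialSum [c] (K + 1) = partialSum [c] K + 2 * altPow c K := by
  rw [partialSum_cons_succ, partialSum_nil_succ]
  rcases K with _ | K
  · simp [altPow]
  · rw [partialSum_nil_succ]
    ring

theorem partialSum_pair_add_swap (a b K : ℕ) :
    partialSum [a, b] K + partialSum [b, a] K = partialSum [a] K * partialSum [b] K := by
  induction K with
  | zero => simp [partialSum]
  | succ K ih =>
    rw [partialSum_cons_succ a [b], partialSum_cons_succ b [a], partialSum_singleton_succ,
      partialSum_singleton_succ]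
    linear_combination ih

/-- Sum of the partial sums over all ways of replacing one of `p` exponents `2` by `d`. -/
noncomputable def insertSum (d p K : ℕ) : ℝ :=
  ∑ i ∈ Finset.range p, partialSum (List.replicate i 2 ++ d :: List.replicate (p - 1 - i) 2) K

theorem insertSum_succ_succ (d p K : ℕ) :
    insertSum d (p + 1) (K + 1) = insertSum d (p + 1) K +
      altPow 2 K * (insertSum d p (K + 1) + insertSum d p K) +
      altPow d K * (partialSum (List.replicate p 2) (K + 1) +
        partialSum (List.replicate p 2) K) := by
  have h : ∀ K, insertSum d (p + 1) K =
      ∑ i ∈ Finset.range p,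
        partialSum (2 :: (List.replicate i 2 ++ d :: List.replicate (p - 1 - i) 2)) K +
      partialSum (d :: List.replicate p 2) K := by
    intro K
    rw [insertSum, Finset.sum_range_succ']
    congr 1
    refine Finset.sum_congr rfl fun i _ => ?_
    rw [List.replicate_succ, List.cons_append, show p + 1 - 1 - (i + 1) = p - 1 - i by omega]
  rw [h, h]
  simp only [partialSum_cons_succ, Finset.sum_add_distrib, ← Finset.mul_sum]
  simp only [insertSum]
  ring

theorem insertSum_one (d p : ℕ) : insertSum d p 1 = 0 := by
  refine Finset.sum_eq_zero fun i _ => ?_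
  rcases i with _ | i
  · exact partialSum_cons_one _ _
  · exact partialSum_cons_one _ _

open PowerSeries in
/-- With `y = altPow 2`, the generating function `F` of the sums with all exponents `2` is
`∏ k, (1 + y k X) / (1 - y k X)`. Replacing one exponent by `d` differentiates this product in the
direction `altPow d`, which multiplies it by `∑ k, 2 (altPow d k) X / (1 - (y k)² X²)`. -/
theorem insertSum_eq_sum (d p K : ℕ) :
    insertSum d p (K + 1) = ∑ q ∈ Finset.HasAntidiagonal.antidiagonal p,
      (if Odd q.1 then partialSum [d + 2 * (q.1 - 1)] (K + 1) else 0) *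
        partialSum (List.replicate q.2 2) (K + 1) := by
  set F : ℕ → PowerSeries ℝ := fun K => .mk fun p => partialSum (List.replicate p 2) K with hF
  set G : ℕ → PowerSeries ℝ := fun K => .mk fun p => insertSum d p K with hG
  set R : ℕ → PowerSeries ℝ := fun K =>
    .mk fun j => if Odd j then partialSum [d + 2 * (j - 1)] K else 0 with hR
  have hFrec : ∀ K, 1 ≤ K → F (K + 1) * (1 - C (altPow 2 K) * X) =
      F K * (1 + C (altPow 2 K) * X) := by
    intro K hK
    suffices h : F (K + 1) = F K + C (altPow 2 K) * ((F (K + 1) + F K) * X) by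
      linear_combination h
    ext p
    rw [map_add, coeff_C_mul]
    rcases p with _ | p
    · obtain ⟨K, rfl⟩ : ∃ q, K = q + 1 := ⟨K - 1, by omega⟩
      rw [coeff_zero_mul_X]
      simp [hF, partialSum_nil_succ]
    · rw [coeff_succ_mul_X]
      simp [hF, List.replicate_succ, partialSum_cons_succ]
  have hGrec : ∀ K, G (K + 1) * (1 - C (altPow 2 K) * X) =
      G K * (1 + C (altPow 2 K) * X) + C (altPow d K) * X * (F (K + 1) + F K) := by
    intro K
    suffices h : G (K + 1) = G K + C (altPow 2 K) * ((G (K + 1) + G K) * X) +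
        C (altPow d K) * ((F (K + 1) + F K) * X) by
      linear_combination h
    ext p
    rw [map_add, map_add, coeff_C_mul, coeff_C_mul]
    rcases p with _ | p
    · rw [coeff_zero_mul_X, coeff_zero_mul_X]
      simp [hG, insertSum]
    · rw [coeff_succ_mul_X, coeff_succ_mul_X]
      simp [hG, hF, insertSum_succ_succ]
  have hRrec : ∀ K, (R (K + 1) - R K) *
      ((1 - C (altPow 2 K) * X) * (1 + C (altPow 2 K) * X)) = 2 * C (altPow d K) * X := by
    intro K
    have hy : ∀ e, altPow (e + 4) K = altPow 2 K ^ 2 * altPow e K := by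
      intro e
      rcases Nat.eq_zero_or_pos K with rfl | hk
      · simp [altPow]
      · have : (K : ℝ) ≠ 0 := by positivity
        have h1 : ((-1 : ℝ) ^ (K + 1)) ^ 2 = 1 := by rw [← pow_mul, mul_comm, pow_mul]; simp
        simp only [altPow, hk.ne', if_false, div_pow, h1]
        field_simp
        ring
    suffices h : R (K + 1) - R K = C (altPow 2 K ^ 2) * ((R (K + 1) - R K) * X * X) +
        C (2 * altPow d K) * X by
      rw [map_mul, map_pow] at h
      have h2 : (C (2 : ℝ) : PowerSeries ℝ) = 2 := map_ofNat C 2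
      rw [h2] at h
      linear_combination h
    ext p
    rw [map_add, coeff_C_mul, coeff_C_mul]
    rcases p with _ | _ | p
    · rw [coeff_zero_mul_X, coeff_zero_X]
      simp [hR]
    · rw [coeff_succ_mul_X, coeff_zero_mul_X]
      simp [hR, coeff_one_X, partialSum_singleton_succ]
    · rw [coeff_succ_mul_X, coeff_succ_mul_X, coeff_X]
      simp only [hR, map_sub, coeff_mk, show Odd (p + 1 + 1) ↔ Odd p by grind]
      by_cases hp : Odd p
      · have h4 : d + 2 * (p + 1 + 1 - 1) = d + 2 * (p - 1) + 4 := by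
          have := hp.pos
          omega
        simp only [hp, if_true, h4, partialSum_singleton_succ, hy]
        simp
        ring
      · simp [hp]
  have hmain : ∀ K, G (K + 1) = R (K + 1) * F (K + 1) := by
    intro K
    induction K with
    | zero =>
      have h1 : G 1 = 0 := by ext p; simp [hG, insertSum_one]
      have h2 : R 1 = 0 := by ext p; simp [hR, partialSum_cons_one]
      rw [h1, h2, zero_mul]
    | succ K ih =>
      -- `1 - y X` is cancelled twice: it is a denominator in the steps of `F`, `G` and in that of `R`.
      have hne : ∀ y : ℝ, (1 + C y * X : PowerSeries ℝ) ≠ 0 := by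
        intro y h
        have := congrArg (coeff 0) h
        simp at this
      have hne' : (1 - C (altPow 2 (K + 1)) * X : PowerSeries ℝ) ≠ 0 := by
        have := hne (-altPow 2 (K + 1))
        rwa [map_neg, neg_mul, ← sub_eq_add_neg] at this
      refine mul_right_cancel₀ (mul_ne_zero hne' hne') ?_
      have e1 := hFrec (K + 1) (by omega)
      have e2 := hGrec (K + 1)
      have e3 := hRrec (K + 1)
      generalize C (altPow 2 (K + 1)) * X = z at *
      generalize C (altPow d (K + 1)) = v at *
      linear_combination (1 - z) * e2 + (1 - z) * (1 + z) * ih +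
        (v * X - (1 - z) * R (K + 1 + 1)) * e1 - F (K + 1) * e3
  have := congrArg (coeff p) (hmain K)
  rw [coeff_mul] at this
  simpa [hG, hR, hF] using this

/-- The limit of `insertSum_eq_sum` for `d = 2 * e + 2`, as an identity between star values. -/
theorem zetaStar_insert_sum (e p : ℕ) :
    ∑ i ∈ Finset.range p,
        zetaStar (word (List.replicate i 0 ++ e :: List.replicate (p - 1 - i) 0)) =
      ∑ q ∈ Finset.HasAntidiagonal.antidiagonal p,
        (if Odd q.1 then zetaStar (word [e + (q.1 - 1)]) else 0) *
          zetaStar (word (List.replicate q.2 0)) := by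
  have hl : Tendsto (fun K => insertSum (2 * e + 2) p (K + 1)) atTop
      (𝓝 (∑ i ∈ Finset.range p,
        zetaStar (word (List.replicate i 0 ++ e :: List.replicate (p - 1 - i) 0)))) := by
    refine tendsto_finsetSum _ fun i _ => ?_
    have h := tendsto_partialSum_word (List.replicate i 0 ++ e :: List.replicate (p - 1 - i) 0)
    simpa [Function.comp_def] using h.comp (tendsto_add_atTop_nat 1)
  refine tendsto_nhds_unique hl ?_
  simp only [insertSum_eq_sum]
  refine tendsto_finsetSum _ fun q _ => Tendsto.mul ?_ ?_
  · split_ifs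
    · have h := (tendsto_partialSum_word [e + (q.1 - 1)]).comp (tendsto_add_atTop_nat 1)
      have h' : 2 * (e + (q.1 - 1)) + 2 = 2 * e + 2 + 2 * (q.1 - 1) := by ring
      simpa [h', Function.comp_def] using h
    · exact tendsto_const_nhds
  · have h := (tendsto_partialSum_word (List.replicate q.2 0)).comp (tendsto_add_atTop_nat 1)
    simpa [Function.comp_def] using h

/-! ### Indices and summation ranges -/

theorem repeatIndex_singleton (a r : ℕ) : repeatIndex [a] r = List.replicate r a := by
  simp [repeatIndex]

theorem repeatIndex_succ (s : List ℕ) (r : ℕ) : repeatIndex s (r + 1) = s ++ repeatIndex s r := by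
  simp [repeatIndex, List.replicate_succ]

theorem word_replicate_even (n : ℕ) : word (List.replicate (2 * n) 0) = repeatIndex [3, 1] n := by
  induction n with
  | zero => rfl
  | succ n ih =>
    rw [show 2 * (n + 1) = 2 * n + 1 + 1 by ring, List.replicate_succ, List.replicate_succ, word,
      ih, repeatIndex_succ]
    rfl

theorem word_replicate_odd (n : ℕ) :
    word (List.replicate (2 * n + 1) 0) = repeatIndex [3, 1] n ++ [2] := by
  induction n with
  | zero => rfl
  | succ n ih =>
    rw [show 2 * (n + 1) + 1 = 2 * n + 1 + 1 + 1 by ring, List.replicate_succ, List.replicate_succ,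
      word, ih, repeatIndex_succ]
    rfl

theorem insertedIndex_eq_word (n : ℕ) (e : Fin (2 * n) → ℕ) :
    insertedIndex n e = word (List.ofFn e) := by
  induction n with
  | zero => rfl
  | succ n ih =>
    have h := ih fun i => e i.succ.succ
    simp only [insertedIndex] at h ⊢
    change List.flatMap _ (List.finRange (2 * n + 1 + 1)) = word (List.ofFn (n := 2 * n + 1 + 1) e)
    rw [List.ofFn_succ, List.ofFn_succ, word, List.finRange_succ, List.finRange_succ]
    refine Eq.trans ?_ (congrArg (fun t => List.replicate (e 0) 2 ++
      3 :: (List.replicate (e (Fin.succ 0)) 2 ++ 1 :: t)) h)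
    have hmod : ∀ i : ℕ, (i + 1 + 1) % 2 = i % 2 := fun i => by omega
    simp [List.flatMap_map, repeatIndex_singleton, hmod]

theorem ofFn_single {p : ℕ} (i : Fin p) :
    List.ofFn (Pi.single i 1 : Fin p → ℕ) =
      List.replicate i 0 ++ 1 :: List.replicate (p - 1 - i) 0 := by
  refine List.ext_getElem (by simp; omega) fun j h1 h2 => ?_
  simp only [List.getElem_ofFn, Pi.single_apply, List.getElem_append, List.length_replicate,
    List.getElem_replicate, List.getElem_cons, Fin.ext_iff]
  grind

theorem sum_piAntidiag_one {p : ℕ} (f : (Fin p → ℕ) → ℝ) :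
    ∑ e ∈ Finset.piAntidiag (Finset.univ : Finset (Fin p)) 1, f e =
      ∑ i, f (Pi.single i 1) := by
  symm
  refine Finset.sum_bij (fun i _ => Pi.single i 1) ?_ ?_ ?_ ?_
  · intro i _
    simp
  · intro i _ j _ h
    by_contra hij
    have := congrFun h i
    simp [hij] at this
  · intro e he
    have hs : ∑ i, e i = 1 := by simpa using he
    obtain ⟨i, hi⟩ : ∃ i, e i ≠ 0 := by
      by_contra! h
      simp [h] at hs
    refine ⟨i, Finset.mem_univ _, ?_⟩
    funext j
    have h1 := Finset.add_sum_erase Finset.univ e (Finset.mem_univ i)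
    by_cases hj : j = i
    · subst hj
      simp only [Pi.single_eq_same]
      omega
    · have h2 := Finset.single_le_sum (f := e) (fun _ _ => Nat.zero_le _)
        (Finset.mem_erase.2 ⟨hj, Finset.mem_univ j⟩)
      simp only [Pi.single_eq_of_ne hj]
      omega
  · intro i _
    rfl

theorem sum_odd_antidiagonal (n : ℕ) (f g : ℕ → ℝ) :
    ∑ q ∈ Finset.HasAntidiagonal.antidiagonal (2 * n + 1), (if Odd q.1 then f q.1 else 0) * g q.2 =
      ∑ p ∈ Finset.HasAntidiagonal.antidiagonal n, f (2 * p.2 + 1) * g (2 * p.1) := by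
  simp only [ite_mul, zero_mul]
  rw [← Finset.sum_filter]
  symm
  refine Finset.sum_bij (fun p _ => (2 * p.2 + 1, 2 * p.1)) ?_ ?_ ?_ ?_
  · rintro ⟨a, b⟩ h
    simp at h ⊢
    omega
  · rintro ⟨a, b⟩ _ ⟨c, d⟩ _ h
    simp at h ⊢
    omega
  · rintro ⟨a, b⟩ h
    simp only [Finset.mem_filter, Finset.HasAntidiagonal.mem_antidiagonal] at h
    obtain ⟨h, k, rfl⟩ := h
    exact ⟨(n - k, k), by simp; omega, by ext <;> simp; omega⟩
  · intro _ _
    rfl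

theorem sum_even_antidiagonal (n : ℕ) (f g : ℕ → ℝ) :
    ∑ q ∈ Finset.HasAntidiagonal.antidiagonal (2 * (n + 1)), (if Odd q.1 then f q.1 else 0) * g q.2 =
      ∑ p ∈ Finset.HasAntidiagonal.antidiagonal n, f (2 * p.2 + 1) * g (2 * p.1 + 1) := by
  have h := sum_odd_antidiagonal n f fun k => g (k + 1)
  rw [← h, show 2 * (n + 1) = 2 * n + 1 + 1 by ring, Finset.Nat.antidiagonal_succ']
  simp [show ¬ Odd (2 * n + 1 + 1) by grind]

end ZetaStar

open ZetaStar in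
theorem mainTheorem4 (m n : ℕ) :
    -- (i)
    (zetaStar (repeatIndex [2] n ++ [3] ++ repeatIndex [2] m ++ [1])
        + zetaStar (repeatIndex [2] m ++ [3] ++ repeatIndex [2] n ++ [1])
      = zetaStar (repeatIndex [2] (n + 1)) * zetaStar (repeatIndex [2] (m + 1))) ∧
    -- (ii)
    ((2 * (n : ℝ) + 1) * zetaStar (repeatIndex [3, 1] n ++ [2])
      = ∑ p ∈ Finset.HasAntidiagonal.antidiagonal n,
          zetaStar (repeatIndex [3, 1] p.1) * zetaStar (repeatIndex [2] (2 * p.2 + 1))) ∧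
    -- (iii)
    (1 ≤ n →
      ∑ e ∈ Finset.piAntidiag (Finset.univ : Finset (Fin (2 * n))) 1,
          zetaStar (insertedIndex n e)
        = ∑ p ∈ Finset.HasAntidiagonal.antidiagonal (n - 1),
            zetaStar (repeatIndex [3, 1] p.1 ++ [2]) *
              zetaStar (repeatIndex [2] (2 * p.2 + 2))) := by
  refine ⟨?_, ?_, fun hn => ?_⟩
  · have hw : ∀ a b : ℕ, repeatIndex [2] a ++ [3] ++ repeatIndex [2] b ++ [1] = word [a, b] := by
      intro a b
      simp [word, repeatIndex_singleton]
    rw [hw, hw]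
    have h2 : ∀ a : ℕ, repeatIndex [2] (a + 1) = word [a] := fun a => repeatIndex_singleton 2 _
    rw [h2, h2]
    have hlim := ((tendsto_partialSum_word [n, m]).add (tendsto_partialSum_word [m, n]))
    refine tendsto_nhds_unique hlim ?_
    refine ((tendsto_partialSum_word [n]).mul (tendsto_partialSum_word [m])).congr fun K => ?_
    exact (partialSum_pair_add_swap _ _ K).symm
  · have h := zetaStar_insert_sum 0 (2 * n + 1)
    rw [sum_odd_antidiagonal n (fun a => zetaStar (word [0 + (a - 1)]))
      (fun b => zetaStar (word (List.replicate b 0)))] at h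
    have h0 : ∀ i ∈ Finset.range (2 * n + 1),
        zetaStar (word (List.replicate i 0 ++ 0 :: List.replicate (2 * n + 1 - 1 - i) 0)) =
          zetaStar (repeatIndex [3, 1] n ++ [2]) := by
      intro i hi
      rw [Finset.mem_range] at hi
      rw [← List.replicate_succ, List.replicate_append_replicate,
        show i + (2 * n + 1 - 1 - i + 1) = 2 * n + 1 by omega, word_replicate_odd]
    rw [Finset.sum_congr rfl h0, Finset.sum_const, Finset.card_range, nsmul_eq_mul] at h
    push_cast at h
    rw [h]
    refine Finset.sum_congr rfl fun p _ => ?_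
    rw [word_replicate_even, repeatIndex_singleton, mul_comm]
    simp [word]
  · obtain ⟨q, rfl⟩ : ∃ q, n = q + 1 := ⟨n - 1, by omega⟩
    have h := zetaStar_insert_sum 1 (2 * (q + 1))
    rw [sum_even_antidiagonal q (fun a => zetaStar (word [1 + (a - 1)]))
      (fun b => zetaStar (word (List.replicate b 0)))] at h
    rw [sum_piAntidiag_one, Nat.add_sub_cancel]
    rw [← Fin.sum_univ_eq_sum_range
      (fun i => zetaStar (word (List.replicate i 0 ++ 1 :: List.replicate (2 * (q + 1) - 1 - i) 0)))]
      at h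
    refine Eq.trans (Finset.sum_congr rfl fun i _ => ?_) (h.trans ?_)
    · rw [insertedIndex_eq_word, ofFn_single]
    · refine Finset.sum_congr rfl fun p _ => ?_
      rw [word_replicate_odd, repeatIndex_singleton, mul_comm, word,
        show 1 + (2 * p.2 + 1 - 1) + 1 = 2 * p.2 + 2 by omega]
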